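/- Let $(X,d)$ be a finite metric space with $n=|X|$ points that embeds isometrically into a (real or complex) Hilbert space. Let $G$ be its critical graph: the graph with vertex set $X$ in which two distinct points $u,v$ are adjacent, written $u\sim v$, if and only if $d(u,v)<d(u,z)+d(z,v)$ for every $z\in X\setminus\{u,v\}$. Here a graph is called $m$-connected if it has more than $m$ vertices and deleting any set of fewer than $m$ vertices leaves a connected graph. If $G$ is $2$-connected but not $3$-connected, then $G$ has a Hamiltonian path $v_1,\dots,v_n$, and there is an integer $k$ with $2\le k\le n-1$ such that, for all $1\le i<j\le n$, $$v_i\sim v_j\quad\Longleftrightarrow\quad j-i=1\ \text{ or }\ i<k<j.$$ -/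

import Mathlib

/-- The critical graph of a metric space: two distinct points `u`, `v` are adjacent iff the
triangle inequality `d(u,v) < d(u,z) + d(z,v)` is strict for every further point `z`. -/
def criticalGraph (X : Type*) [MetricSpace X] : SimpleGraph X where
  Adj u v := u ≠ v ∧ ∀ z : X, z ≠ u → z ≠ v → dist u v < dist u z + dist z v
  symm := ⟨fun u v h => ⟨h.1.symm, fun z hv hu => by
    have := h.2 z hu hv
    rw [dist_comm v u, dist_comm v z, dist_comm z u]
    linarith⟩⟩
  loopless := ⟨fun _ h => h.1 rfl⟩

/-- `k`-(vertex-)connectedness: `G` has more than `k` vertices, and deleting any set of fewer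
than `k` vertices leaves a connected graph. -/
def SimpleGraph.IsVertexKConnected {V : Type*} (G : SimpleGraph V) (k : ℕ) : Prop :=
  (k : ℕ∞) < ENat.card V ∧
    ∀ S : Finset V, S.card < k → (G.induce ((S : Set V)ᶜ)).Connected

/-! In a strictly convex space, equality in the triangle inequality means betweenness, so `G` is the
visibility graph of a finite point set. The set is not collinear, since an inner point of a line
would be a cut vertex. With more than three points, some pair `s`, `t` separates the rest into `A`
and `B`, and every segment from `A` to `B` passes through `s` or `t` (`exists_sbtw_of_separation`).
Give each point the slopes `u` and `w` of its lines to `s` and `t`. The sets `A` and `B` lie on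
opposite sides of the line `st`, so on opposite sides of the diagonal `u = w`, and any `a`, `b`
agree in `u` or in `w`. If both sets have two points, this forces one common slope
(`eq_const_of_axis_parallel`): all points but one are collinear. Hence in every case the points lie
on two rays from a common apex (`exists_two_rays_of_separation`). Two points see each other there
exactly when they are consecutive along the bent line or strictly on different rays; the apex is
`v_k`. -/

/-- A real-valued injection on a finite type enumerates it in increasing order. -/
theorem exists_strictMono_enumeration {X : Type*} [Finite X] [Nonempty X] (f : X → ℝ)
    (hf : Function.Injective f) :
    ∃ u : ℕ → X, (∀ i j, i < j → j < Nat.card X → f (u i) < f (u j)) ∧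
      ∀ x, ∃ i < Nat.card X, u i = x := by
  classical
  have := Fintype.ofFinite X
  let _ : LinearOrder X := LinearOrder.lift' f hf
  have hlt : ∀ x y : X, x < y → f x < f y := fun x y h => h
  let e : Fin (Nat.card X) ≃o X :=
    Fintype.orderIsoFinOfCardEq X (Nat.card_eq_fintype_card (α := X)).symm
  refine ⟨fun i => if h : i < Nat.card X then e ⟨i, h⟩ else Classical.arbitrary X, ?_, ?_⟩
  · intro i j hij hj
    simp only [hj, hij.trans hj, dif_pos]
    exact hlt _ _ (e.strictMono (by simpa using hij))
  · intro x
    refine ⟨e.symm x, (e.symm x).2, ?_⟩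
    exact (dif_pos (e.symm x).2).trans (e.apply_symm_apply x)

/-! ### Hamiltonian paths from labels, and separations -/

namespace SimpleGraph

/-- A sequence of successively adjacent vertices is traced by a walk. -/
theorem exists_walk_getVert_eq {V : Type*} {G : SimpleGraph V} (u : ℕ → V) (m : ℕ)
    (h : ∀ i < m, G.Adj (u i) (u (i + 1))) :
    ∃ p : G.Walk (u 0) (u m), p.length = m ∧ ∀ i ≤ m, p.getVert i = u i := by
  induction m generalizing u with
  | zero => exact ⟨.nil, rfl, fun i hi => by simp [Nat.le_zero.1 hi]⟩
  | succ m ih =>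
    obtain ⟨p, hp, hu⟩ := ih (fun i => u (i + 1)) fun i hi => h (i + 1) (by omega)
    refine ⟨.cons (h 0 (by omega)) p, by simp [hp], fun i hi => ?_⟩
    cases i with
    | zero => simp
    | succ i => simpa using hu i (by omega)

/-- A walk through the values of an injective enumeration of the vertices is Hamiltonian. -/
theorem Walk.isHamiltonian_of_getVert_eq {V : Type*} [DecidableEq V] {G : SimpleGraph V}
    {a b : V} (p : G.Walk a b) (u : ℕ → V) (hu : ∀ i ≤ p.length, p.getVert i = u i)
    (hinj : ∀ i j, i < j → j ≤ p.length → u i ≠ u j) (hsurj : ∀ x, ∃ i ≤ p.length, u i = x) :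
    p.IsHamiltonian := by
  refine IsPath.isHamiltonian_of_mem ?_ fun x => ?_
  · rw [← IsPath.getVert_injOn_iff]
    intro i hi j hj hij
    simp only [Set.mem_ofPred_eq] at hi hj
    rw [hu i hi, hu j hj] at hij
    rcases lt_trichotomy i j with h | h | h
    · exact absurd hij (hinj i j h hj)
    · exact h
    · exact absurd hij.symm (hinj j i h hi)
  · obtain ⟨i, hi, rfl⟩ := hsurj x
    exact Walk.mem_support_iff_exists_getVert.2 ⟨i, hu i hi, hi⟩

/-- If the vertices carry real labels such that vertices are adjacent exactly when their labels are
consecutive or of opposite sign, the graph is a Hamiltonian path together with all the edges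
across the vertex labelled `0`. -/
theorem exists_hamiltonian_of_label {X : Type*} [Finite X] [DecidableEq X] (G : SimpleGraph X)
    (f : X → ℝ) (hf : Function.Injective f)
    (hG : ∀ x y, f x < f y →
      (G.Adj x y ↔ (∀ z, ¬ (f x < f z ∧ f z < f y)) ∨ (f x < 0 ∧ 0 < f y)))
    (v : X) (hv : f v = 0) (hneg : ∃ x, f x < 0) (hpos : ∃ x, 0 < f x) :
    ∃ (a b : X) (p : G.Walk a b), p.IsHamiltonian ∧
      ∃ k : ℕ, 2 ≤ k ∧ k + 1 ≤ Nat.card X ∧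
        ∀ i j : ℕ, 1 ≤ i → i < j → j ≤ Nat.card X →
          (G.Adj (p.getVert (i - 1)) (p.getVert (j - 1)) ↔ j = i + 1 ∨ (i < k ∧ k < j)) := by
  have : Nonempty X := ⟨v⟩
  obtain ⟨u, hu, hs⟩ := exists_strictMono_enumeration f hf
  have hcard : 0 < Nat.card X := Nat.card_pos
  have hlt : ∀ i j, i < Nat.card X → j < Nat.card X → (f (u i) < f (u j) ↔ i < j) := by
    intro i j hi hj
    refine ⟨fun h => ?_, fun h => hu i j h hj⟩
    by_contra hij
    rcases (not_lt.1 hij).lt_or_eq with h' | rfl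
    · exact lt_asymm h (hu j i h' hi)
    · exact lt_irrefl _ h
  obtain ⟨k, hk, rfl⟩ := hs v
  have hadj : ∀ i j, i < j → j < Nat.card X →
      (G.Adj (u i) (u j) ↔ j = i + 1 ∨ (i < k ∧ k < j)) := by
    intro i j hij hj
    rw [hG _ _ (hu i j hij hj), ← hv, hlt i k (by omega) hk, hlt k j hk hj]
    refine or_congr ⟨fun h => ?_, fun h z hz => ?_⟩ Iff.rfl
    · by_contra hne
      exact h (u (i + 1)) ⟨hu _ _ (by omega) (by omega), hu _ _ (by omega) hj⟩
    · obtain ⟨l, hl, rfl⟩ := hs z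
      rw [hlt i l (by omega) hl, hlt l j hl hj] at hz
      omega
  obtain ⟨p, hp, hpu⟩ := exists_walk_getVert_eq (G := G) u (Nat.card X - 1)
    fun i hi => (hadj i (i + 1) (by omega) (by omega)).2 (Or.inl rfl)
  -- The enumeration starts at 0 and the statement counts from 1, hence `k + 1`.
  refine ⟨_, _, p, p.isHamiltonian_of_getVert_eq u (by rwa [hp]) ?_ ?_, k + 1, ?_, ?_, ?_⟩
  · intro i j hij hj h
    have := hu i j hij (by omega)
    rw [h] at this
    exact lt_irrefl _ this
  · intro x
    obtain ⟨i, hi, rfl⟩ := hs x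
    exact ⟨i, by omega, rfl⟩
  · obtain ⟨x, hx⟩ := hneg
    obtain ⟨i, hi, rfl⟩ := hs x
    rw [← hv, hlt i k hi hk] at hx
    omega
  · obtain ⟨x, hx⟩ := hpos
    obtain ⟨i, hi, rfl⟩ := hs x
    rw [← hv, hlt k i hk hi] at hx
    omega
  · intro i j hi hij hj
    rw [hpu _ (by omega), hpu _ (by omega), hadj _ _ (by omega) (by omega)]
    omega

/-- In a disconnected graph the vertices split into two nonempty parts without edges between. -/
theorem exists_separation_of_not_preconnected {V : Type*} {G : SimpleGraph V}
    (h : ¬ G.Preconnected) :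
    ∃ A : Set V, A.Nonempty ∧ Aᶜ.Nonempty ∧ ∀ a ∈ A, ∀ b ∉ A, ¬ G.Adj a b := by
  simp only [Preconnected, not_forall] at h
  obtain ⟨a, b, hab⟩ := h
  refine ⟨{x | G.Reachable a x}, ⟨a, Reachable.refl a⟩, ⟨b, hab⟩, fun x hx y hy hxy => ?_⟩
  exact hy (Reachable.trans hx hxy.reachable)

/-- A connected graph has an edge leaving every set of vertices that is not empty or full. -/
theorem Preconnected.exists_adj_of_mem_of_notMem {V : Type*} {G : SimpleGraph V}
    (h : G.Preconnected) (A : Set V) {a b : V} (ha : a ∈ A) (hb : b ∉ A) :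
    ∃ x ∈ A, ∃ y ∉ A, G.Adj x y := by
  obtain ⟨p⟩ := h a b
  obtain ⟨d, -, h1, h2⟩ := p.exists_boundary_dart A ha hb
  exact ⟨_, h1, _, h2, d.adj⟩

end SimpleGraph

/-! ### Visibility on two rays -/

/-- Betweenness in coordinates with respect to two independent vectors. -/
theorem sbtw_iff_of_independent {E : Type*} [AddCommGroup E] [Module ℝ E] {e₁ e₂ o : E}
    (he : ∀ a b : ℝ, a • e₁ + b • e₂ = 0 → a = 0 ∧ b = 0) (a₁ a₂ b₁ b₂ c₁ c₂ : ℝ)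
    (hab : a₁ ≠ b₁ ∨ a₂ ≠ b₂) :
    Sbtw ℝ (o + (a₁ • e₁ + a₂ • e₂)) (o + (c₁ • e₁ + c₂ • e₂)) (o + (b₁ • e₁ + b₂ • e₂)) ↔
      ∃ t : ℝ, 0 < t ∧ t < 1 ∧ c₁ = a₁ + t * (b₁ - a₁) ∧ c₂ = a₂ + t * (b₂ - a₂) := by
  rw [sbtw_iff_mem_image_Ioo_and_ne]
  constructor
  · rintro ⟨⟨t, ⟨h0, h1⟩, ht⟩, -⟩
    rw [AffineMap.lineMap_apply_module'] at ht
    have := he (a₁ + t * (b₁ - a₁) - c₁) (a₂ + t * (b₂ - a₂) - c₂) (by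
      rw [← sub_eq_zero] at ht
      rw [← ht]
      module)
    exact ⟨t, h0, h1, by linarith [this.1], by linarith [this.2]⟩
  · rintro ⟨t, h0, h1, rfl, rfl⟩
    refine ⟨⟨t, ⟨h0, h1⟩, ?_⟩, fun h => ?_⟩
    · rw [AffineMap.lineMap_apply_module']
      module
    · have := he (a₁ - b₁) (a₂ - b₂) (by
        rw [← sub_eq_zero] at h
        rw [← h]
        module)
      rcases hab with hab | hab
      · exact hab (by linarith [this.1])
      · exact hab (by linarith [this.2])

theorem Sbtw.exists_eq_smul {E : Type*} [AddCommGroup E] [Module ℝ E] {a s b : E}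
    (h : Sbtw ℝ a s b) : ∃ r : ℝ, 0 < r ∧ b - s = -r • (a - s) := by
  rw [sbtw_iff_mem_image_Ioo_and_ne] at h
  obtain ⟨⟨t, ⟨h0, h1⟩, rfl⟩, -⟩ := h
  rw [AffineMap.lineMap_apply_module']
  refine ⟨(1 - t) / t, div_pos (by linarith) h0, ?_⟩
  match_scalars <;> field_simp
  ring

/-- A finite visibility graph supported on two rays with common origin, not on one line. -/
theorem exists_hamiltonian_of_two_rays {X E : Type*} [Finite X] [DecidableEq X] [AddCommGroup E]
    [Module ℝ E] (G : SimpleGraph X) (φ : X → E) (hφ : Function.Injective φ)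
    (hG : ∀ x y, G.Adj x y ↔ x ≠ y ∧ ∀ z, ¬ Sbtw ℝ (φ x) (φ z) (φ y))
    (v p q : X)
    (he : ∀ a b : ℝ, a • (φ p - φ v) + b • (φ q - φ v) = 0 → a = 0 ∧ b = 0)
    (hray : ∀ x, x ≠ v → ∃ r : ℝ, 0 < r ∧
      (φ x - φ v = r • (φ p - φ v) ∨ φ x - φ v = r • (φ q - φ v))) :
    ∃ (a b : X) (p : G.Walk a b), p.IsHamiltonian ∧
      ∃ k : ℕ, 2 ≤ k ∧ k + 1 ≤ Nat.card X ∧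
        ∀ i j : ℕ, 1 ≤ i → i < j → j ≤ Nat.card X →
          (G.Adj (p.getVert (i - 1)) (p.getVert (j - 1)) ↔ j = i + 1 ∨ (i < k ∧ k < j)) := by
  set e₁ := φ p - φ v with he₁
  set e₂ := φ q - φ v with he₂
  -- The label is the signed position along the bent line: negative on the ray to `p`, positive on
  -- the ray to `q`.
  have hf : ∀ x, ∃ f : ℝ, φ x = φ v + (max (-f) 0 • e₁ + max f 0 • e₂) := by
    intro x
    by_cases hx : x = v
    · exact ⟨0, by simp [hx]⟩
    · obtain ⟨r, hr, h | h⟩ := hray x hx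
      · refine ⟨-r, ?_⟩
        rw [neg_neg, max_eq_left hr.le, max_eq_right (by linarith), ← h]
        module
      · refine ⟨r, ?_⟩
        rw [max_eq_left hr.le, max_eq_right (by linarith), ← h]
        module
  choose f hf using hf
  have huniq : ∀ x (c₁ c₂ : ℝ), φ x = φ v + (c₁ • e₁ + c₂ • e₂) →
      max (-f x) 0 = c₁ ∧ max (f x) 0 = c₂ := by
    intro x c₁ c₂ h
    have := he (max (-f x) 0 - c₁) (max (f x) 0 - c₂) (by
      rw [hf x, ← sub_eq_zero] at h
      rw [← h]
      module)
    exact ⟨by linarith [this.1], by linarith [this.2]⟩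
  have hmax : ∀ r : ℝ, r = max r 0 - max (-r) 0 := by
    intro r
    rcases le_total r 0 with h | h
    · rw [max_eq_right h, max_eq_left (by linarith)]
      ring
    · rw [max_eq_left h, max_eq_right (by linarith)]
      ring
  have hinj : Function.Injective f := fun x y h => hφ (by rw [hf x, hf y, h])
  refine SimpleGraph.exists_hamiltonian_of_label G f hinj ?_ v ?_ ⟨p, ?_⟩ ⟨q, ?_⟩
  · intro x y hxy
    have hS : ∀ z, Sbtw ℝ (φ x) (φ z) (φ y) ↔ ∃ t : ℝ, 0 < t ∧ t < 1 ∧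
        max (-f z) 0 = max (-f x) 0 + t * (max (-f y) 0 - max (-f x) 0) ∧
        max (f z) 0 = max (f x) 0 + t * (max (f y) 0 - max (f x) 0) := by
      intro z
      conv_lhs => rw [hf x, hf y, hf z]
      refine sbtw_iff_of_independent he _ _ _ _ _ _ ?_
      by_contra! h
      linarith [hmax (f x), hmax (f y), h.1, h.2]
    have hne : x ≠ y := by
      rintro rfl
      exact lt_irrefl _ hxy
    simp only [hG, hne, ne_eq, not_false_eq_true, true_and, hS]
    by_cases hs : f x < 0 ∧ 0 < f y
    · simp only [hs, and_self, or_true, iff_true]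
      -- A blocking point would have both coordinates positive, so it would lie on neither ray.
      rintro z ⟨t, h0, h1, h2, h3⟩
      rw [max_eq_left (by linarith : 0 ≤ -f x), max_eq_right (by linarith : -f y ≤ 0)] at h2
      rw [max_eq_right (by linarith : f x ≤ 0), max_eq_left (by linarith : 0 ≤ f y)] at h3
      have h4 : 0 < max (-f z) 0 := by
        rw [h2]
        nlinarith
      have h5 : 0 < max (f z) 0 := by
        rw [h3]
        nlinarith
      have h6 : f z < 0 := by simpa using h4
      have h7 : 0 < f z := by simpa using h5
      linarith
    · simp only [hs, or_false]
      refine forall_congr' fun z => not_congr ⟨?_, ?_⟩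
      · rintro ⟨t, h0, h1, h2, h3⟩
        have hd : 0 < f y - f x := by linarith
        have h4 : 0 < t * (f y - f x) := mul_pos h0 hd
        have h5 : 0 < (1 - t) * (f y - f x) := mul_pos (by linarith) hd
        have key : f z = f x + t * (f y - f x) := by
          linear_combination h3 - h2 + hmax (f z) - (1 - t) * hmax (f x) - t * hmax (f y)
        constructor <;> linarith
      · rintro ⟨h1, h2⟩
        have hd : 0 < f y - f x := by linarith
        have key : (f z - f x) / (f y - f x) * (f y - f x) = f z - f x :=
          div_mul_cancel₀ _ hd.ne'
        refine ⟨(f z - f x) / (f y - f x), div_pos (by linarith) hd,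
          (div_lt_one hd).2 (by linarith), ?_⟩
        rcases le_or_gt 0 (f x) with h | h
        · rw [max_eq_right (by linarith : -f z ≤ 0), max_eq_right (by linarith : -f x ≤ 0),
            max_eq_right (by linarith : -f y ≤ 0), max_eq_left (by linarith : 0 ≤ f z),
            max_eq_left h, max_eq_left (by linarith : 0 ≤ f y)]
          constructor <;> linarith
        · have h' : f y ≤ 0 := by
            by_contra h'
            exact hs ⟨h, not_le.1 h'⟩
          rw [max_eq_left (by linarith : 0 ≤ -f z), max_eq_left (by linarith : 0 ≤ -f x),
            max_eq_left (by linarith : 0 ≤ -f y), max_eq_right (by linarith : f z ≤ 0),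
            max_eq_right h.le, max_eq_right h']
          constructor <;> linarith
  · have := huniq v 0 0 (by simp)
    linarith [this.1, this.2, hmax (f v)]
  · have := huniq p 1 0 (by simp [he₁])
    linarith [this.1, this.2, hmax (f p)]
  · have := huniq q 0 1 (by simp [he₂])
    linarith [this.1, this.2, hmax (f q)]

/-! ### From a separating pair to two rays -/

/-- If all edges of the complete bipartite graph between two sets of plane points, one above and
one below the diagonal, are parallel to a coordinate axis, all points lie on one such line. -/
theorem eq_const_of_axis_parallel {X : Type*} {A B : Set X} {u w : X → ℝ}
    (hA : ∀ a ∈ A, w a < u a) (hB : ∀ b ∈ B, u b < w b)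
    (h : ∀ a ∈ A, ∀ b ∈ B, u a = u b ∨ w a = w b)
    (hinj : ∀ x ∈ A ∪ B, ∀ y ∈ A ∪ B, u x = u y → w x = w y → x = y)
    {a a' b b' : X} (ha : a ∈ A) (ha' : a' ∈ A) (haa : a ≠ a') (hb : b ∈ B) (hb' : b' ∈ B)
    (hbb : b ≠ b') :
    (∃ c, ∀ x ∈ A ∪ B, u x = c) ∨ ∃ c, ∀ x ∈ A ∪ B, w x = c := by
  have hAi : a ∈ A ∪ B := Or.inl ha
  have hAi' : a' ∈ A ∪ B := Or.inl ha'
  have hBi : b ∈ A ∪ B := Or.inr hb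
  have hBi' : b' ∈ A ∪ B := Or.inr hb'
  have h₁ := hinj a hAi a' hAi'
  have h₂ := hinj b hBi b' hBi'
  -- Mixed patterns either identify two of the points, or give a point of `A` and one of `B` the
  -- same coordinates, or form a rectangle with opposite corners on the same side of the diagonal;
  -- that rectangle would give a cyclic chain of strict inequalities.
  have key : (u a = u b ∧ u a' = u b ∧ u b' = u b) ∨ (w a = w b ∧ w a' = w b ∧ w b' = w b) := by
    have := hA a ha
    have := hA a' ha'
    have := hB b hb
    have := hB b' hb'
    rcases h a ha b hb with h1 | h1 <;> rcases h a ha b' hb' with h2 | h2 <;>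
      rcases h a' ha' b hb with h3 | h3 <;> rcases h a' ha' b' hb' with h4 | h4 <;> grind
  refine key.imp (fun k => ⟨u b, ?_⟩) (fun k => ⟨w b, ?_⟩)
  · rintro x (hx | hx)
    · have := h x hx b hb
      have := h x hx b' hb'
      grind
    · have := h a ha x hx
      have := h a' ha' x hx
      grind
  · rintro x (hx | hx)
    · have := h x hx b hb
      have := h x hx b' hb'
      grind
    · have := h a ha x hx
      have := h a' ha' x hx
      grind

/-- A finite set lying on a line except for one point lies on two rays with common origin. -/
theorem exists_two_rays_of_line {X E : Type*} [Finite X] [AddCommGroup E] [Module ℝ E]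
    (φ : X → E) (hφ : Function.Injective φ) (t : X) (o d : E)
    (h : ∀ x, x ≠ t → ∃ r : ℝ, φ x = o + r • d) {x y : X} (hx : x ≠ t) (hy : y ≠ t)
    (hxy : x ≠ y) :
    ∃ v p q : X, ∀ x, x ≠ v → ∃ r : ℝ, 0 < r ∧
      (φ x - φ v = r • (φ p - φ v) ∨ φ x - φ v = r • (φ q - φ v)) := by
  choose! f hf using h
  have : Nonempty {x // x ≠ t} := ⟨⟨x, hx⟩⟩
  -- The apex is an extreme point of the line; the second ray goes to `t`.
  obtain ⟨⟨v, hv⟩, hmin⟩ := Finite.exists_min fun x : {x // x ≠ t} => f x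
  have hlt : ∀ x, x ≠ t → x ≠ v → 0 < f x - f v := by
    intro x hx hxv
    refine sub_pos.2 (lt_of_le_of_ne (hmin ⟨x, hx⟩) fun h => hxv (hφ ?_))
    rw [hf x hx, hf v hv]
    exact congrArg (fun r : ℝ => o + r • d) h.symm
  obtain ⟨p, hp, hpv⟩ : ∃ p, p ≠ t ∧ p ≠ v := by
    by_cases h : x = v
    · exact ⟨y, hy, fun h' => hxy (h.trans h'.symm)⟩
    · exact ⟨x, hx, h⟩
  refine ⟨v, p, t, fun x hxv => ?_⟩
  by_cases hxt : x = t
  · exact ⟨1, one_pos, Or.inr (by rw [hxt, one_smul])⟩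
  · have h1 := hlt p hp hpv
    refine ⟨(f x - f v) / (f p - f v), div_pos (hlt x hxt hxv) h1, Or.inl ?_⟩
    rw [hf x hxt, hf v hv, hf p hp]
    match_scalars <;> field_simp
    ring

/-- The single point `a` serves as apex: every point of `B` lies behind `s` or `t` as seen from it.
-/
theorem exists_two_rays_of_subsingleton {X E : Type*} [AddCommGroup E] [Module ℝ E] (φ : X → E)
    {A B : Set X} {s t a : X} (hcov : ∀ x, x ∈ A ∨ x ∈ B ∨ x = s ∨ x = t)
    (hsep : ∀ a ∈ A, ∀ b ∈ B, Sbtw ℝ (φ a) (φ s) (φ b) ∨ Sbtw ℝ (φ a) (φ t) (φ b))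
    (ha : a ∈ A) (hA : A.Subsingleton) :
    ∃ v p q : X, ∀ x, x ≠ v → ∃ r : ℝ, 0 < r ∧
      (φ x - φ v = r • (φ p - φ v) ∨ φ x - φ v = r • (φ q - φ v)) := by
  refine ⟨a, s, t, fun x hx => ?_⟩
  rcases hcov x with h | h | rfl | rfl
  · exact absurd (hA h ha) hx
  · rcases hsep a ha x h with h | h
    · obtain ⟨r, hr, h⟩ := h.exists_eq_smul
      refine ⟨1 + r, by linarith, Or.inl ?_⟩
      rw [← sub_add_sub_cancel _ (φ s), h]
      module
    · obtain ⟨r, hr, h⟩ := h.exists_eq_smul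
      refine ⟨1 + r, by linarith, Or.inr ?_⟩
      rw [← sub_add_sub_cancel _ (φ t), h]
      module
  · exact ⟨1, one_pos, Or.inl (one_smul _ _).symm⟩
  · exact ⟨1, one_pos, Or.inr (one_smul _ _).symm⟩

theorem Sbtw.exists_eq_add_smul {E : Type*} [AddCommGroup E] [Module ℝ E] {a s b o d : E}
    (h : Sbtw ℝ a s b) (ha : ∃ r : ℝ, a = o + r • d) (hs : ∃ r : ℝ, s = o + r • d) :
    ∃ r : ℝ, b = o + r • d := by
  obtain ⟨c, -, h⟩ := h.exists_eq_smul
  obtain ⟨r, rfl⟩ := ha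
  obtain ⟨q, rfl⟩ := hs
  refine ⟨q - c * (r - q), ?_⟩
  rw [← sub_add_cancel b (o + q • d), h]
  module

/-- If every segment joining `A` to `B` meets one of two further points, and the points are not
on one line, no point of `A` is on the line through these two. -/
theorem linearIndependent_of_separation {X E : Type*} [AddCommGroup E] [Module ℝ E] (φ : X → E)
    (hφ : Function.Injective φ) (hnc : ¬ ∃ o d : E, ∀ x, ∃ r : ℝ, φ x = o + r • d)
    {A B : Set X} {s t a₀ : X} (hst : s ≠ t) (hcov : ∀ x, x ∈ A ∨ x ∈ B ∨ x = s ∨ x = t)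
    (hsep : ∀ a ∈ A, ∀ b ∈ B, Sbtw ℝ (φ a) (φ s) (φ b) ∨ Sbtw ℝ (φ a) (φ t) (φ b))
    (ha : a₀ ∈ A) (hB : B.Nonempty) (α β : ℝ)
    (h : α • (φ t - φ s) + β • (φ a₀ - φ s) = 0) : α = 0 ∧ β = 0 := by
  by_cases hβ : β = 0
  · subst hβ
    refine ⟨?_, rfl⟩
    simpa [sub_eq_zero, hφ.ne hst.symm] using h
  · exfalso
    -- If `a₀` were on the line `st`, the blocked segments would put all of `B` on it, and then all
    -- of `A`.
    refine hnc ⟨φ s, φ t - φ s, ?_⟩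
    have hs : ∃ r : ℝ, φ s = φ s + r • (φ t - φ s) := ⟨0, by simp⟩
    have ht : ∃ r : ℝ, φ t = φ s + r • (φ t - φ s) := ⟨1, by simp⟩
    have ha₀ : ∃ r : ℝ, φ a₀ = φ s + r • (φ t - φ s) := by
      refine ⟨-(α / β), ?_⟩
      have h1 : φ a₀ - φ s = -(α / β) • (φ t - φ s) := by
        have h2 : β⁻¹ • (α • (φ t - φ s) + β • (φ a₀ - φ s)) = 0 := by rw [h, smul_zero]
        rw [smul_add, smul_smul, smul_smul, inv_mul_cancel₀ hβ, one_smul] at h2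
        rw [eq_neg_of_add_eq_zero_right h2, div_eq_inv_mul, neg_smul]
      rw [← h1]
      module
    have hBl : ∀ b ∈ B, ∃ r : ℝ, φ b = φ s + r • (φ t - φ s) := fun b hb =>
      (hsep a₀ ha b hb).elim (fun h => h.exists_eq_add_smul ha₀ hs)
        fun h => h.exists_eq_add_smul ha₀ ht
    obtain ⟨b, hb⟩ := hB
    intro x
    rcases hcov x with hx | hx | rfl | rfl
    · exact (hsep x hx b hb).elim (fun h => h.symm.exists_eq_add_smul (hBl b hb) hs)
        fun h => h.symm.exists_eq_add_smul (hBl b hb) ht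
    · exact hBl x hx
    · exact hs
    · exact ht

/-- Here `u` is the slope seen from `s` and `u - y⁻¹` the slope seen from `t`. Passing through `s`
or `t` preserves the corresponding slope and flips the sign of the height `y`. -/
theorem exists_coordinates_of_sbtw {E : Type*} [AddCommGroup E] [Module ℝ E] {a b s t f : E}
    {y u : ℝ} (hy : y ≠ 0) (ha : a - s = y • (u • (t - s) + f))
    (h : Sbtw ℝ a s b ∨ Sbtw ℝ a t b) :
    ∃ y' u' : ℝ, y' * y < 0 ∧ b - s = y' • (u' • (t - s) + f) := by
  have hyy : 0 < y * y := mul_self_pos.2 hy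
  rcases h with h | h
  · obtain ⟨r, hr, h⟩ := h.exists_eq_smul
    refine ⟨-r * y, u, by nlinarith, ?_⟩
    rw [h, ha]
    module
  · obtain ⟨r, hr, h⟩ := h.exists_eq_smul
    refine ⟨-r * y, (1 + r - r * y * u) / (-r * y), by nlinarith, ?_⟩
    have h1 : a = s + y • (u • (t - s) + f) := by
      rw [← ha]
      module
    rw [← sub_add_sub_cancel b t s, h, h1]
    match_scalars <;> field_simp <;> ring

/-- A finite set of points not on one line, in which two points block all segments between two
nonempty classes of the remaining points, lies on two rays with common origin. -/
theorem exists_two_rays_of_separation {X E : Type*} [Finite X] [AddCommGroup E] [Module ℝ E]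
    (φ : X → E) (hφ : Function.Injective φ) (hnc : ¬ ∃ o d : E, ∀ x, ∃ r : ℝ, φ x = o + r • d)
    {A B : Set X} {s t : X} (hst : s ≠ t) (hcov : ∀ x, x ∈ A ∨ x ∈ B ∨ x = s ∨ x = t)
    (hsep : ∀ a ∈ A, ∀ b ∈ B, Sbtw ℝ (φ a) (φ s) (φ b) ∨ Sbtw ℝ (φ a) (φ t) (φ b))
    (hA : A.Nonempty) (hB : B.Nonempty) (hs : s ∉ A) (ht : t ∉ A) :
    ∃ v p q : X, ∀ x, x ≠ v → ∃ r : ℝ, 0 < r ∧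
      (φ x - φ v = r • (φ p - φ v) ∨ φ x - φ v = r • (φ q - φ v)) := by
  by_cases hA1 : A.Subsingleton
  · exact exists_two_rays_of_subsingleton φ hcov hsep hA.some_mem hA1
  by_cases hB1 : B.Subsingleton
  · exact exists_two_rays_of_subsingleton φ (A := B) (B := A) (fun x => or_left_comm.1 (hcov x))
      (fun b hb a ha => (hsep a ha b hb).imp Sbtw.symm Sbtw.symm) hB.some_mem hB1
  obtain ⟨a, ha, a', ha', haa⟩ := Set.not_subsingleton_iff.1 hA1
  obtain ⟨b, hb, b', hb', hbb⟩ := Set.not_subsingleton_iff.1 hB1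
  have hind := linearIndependent_of_separation φ hφ hnc hst hcov hsep ha hB
  have hBc : ∀ x ∈ B, ∃ y u : ℝ, y < 0 ∧
      φ x - φ s = y • (u • (φ t - φ s) + (φ a - φ s)) := by
    intro x hx
    obtain ⟨y, u, hy, h⟩ := exists_coordinates_of_sbtw (y := 1) (u := 0) (f := φ a - φ s)
      one_ne_zero (by module) (hsep a ha x hx)
    exact ⟨y, u, by linarith, h⟩
  have hAc : ∀ x ∈ A, ∃ y u : ℝ, 0 < y ∧
      φ x - φ s = y • (u • (φ t - φ s) + (φ a - φ s)) := by
    intro x hx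
    -- Going from `a` to `b` and back to `x` flips the sign twice.
    obtain ⟨y₀, u₀, hy₀, h₀⟩ := hBc b hb
    obtain ⟨y, u, hy, h⟩ := exists_coordinates_of_sbtw hy₀.ne h₀
      ((hsep x hx b hb).imp Sbtw.symm Sbtw.symm)
    exact ⟨y, u, by nlinarith, h⟩
  have hc : ∀ x, ∃ y u : ℝ, (x ∈ A → 0 < y) ∧ (x ∈ B → y < 0) ∧ (x ∈ A ∪ B →
      φ x - φ s = y • (u • (φ t - φ s) + (φ a - φ s))) := by
    intro x
    by_cases hx : x ∈ A
    · obtain ⟨y, u, hy, h⟩ := hAc x hx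
      refine ⟨y, u, fun _ => hy, fun hxB => ?_, fun _ => h⟩
      exfalso
      obtain ⟨y', u', hy', h'⟩ := hBc x hxB
      have := (hind (y * u - y' * u') (y - y') (by
        rw [h', ← sub_eq_zero] at h
        rw [← neg_eq_zero, ← h]
        module)).2
      linarith
    · by_cases hxB : x ∈ B
      · obtain ⟨y, u, hy, h⟩ := hBc x hxB
        exact ⟨y, u, fun h => absurd h hx, fun _ => hy, fun _ => h⟩
      · exact ⟨0, 0, fun h => absurd h hx, fun h => absurd h hxB,
          fun h => absurd h (by simp [hx, hxB])⟩
  choose y u hyA hyB hyu using hc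
  have hyne : ∀ x ∈ A ∪ B, y x ≠ 0 := by
    rintro x (hx | hx)
    · exact (hyA x hx).ne'
    · exact (hyB x hx).ne
  have hval : ∀ x ∈ A ∪ B, φ x = φ s + y x • (u x • (φ t - φ s) + (φ a - φ s)) := by
    intro x hx
    rw [← hyu x hx]
    module
  have hpar : ∀ a ∈ A, ∀ b ∈ B, u a = u b ∨ u a - (y a)⁻¹ = u b - (y b)⁻¹ := by
    intro a₁ h₁ b₁ h₂
    have n₁ := hyne a₁ (Or.inl h₁)
    have n₂ := hyne b₁ (Or.inr h₂)
    have v₁ := hval a₁ (Or.inl h₁)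
    have v₂ := hval b₁ (Or.inr h₂)
    refine (hsep a₁ h₁ b₁ h₂).imp (fun h => ?_) fun h => ?_
    · obtain ⟨r, hr, h⟩ := h.exists_eq_smul
      obtain ⟨k₁, k₂⟩ := hind (y b₁ * u b₁ + r * (y a₁ * u a₁)) (y b₁ + r * y a₁) (by
        rw [v₁, v₂, ← sub_eq_zero] at h
        rw [← h]
        module)
      have : y b₁ * (u a₁ - u b₁) = 0 := by linear_combination u a₁ * k₂ - k₁
      linarith [(mul_eq_zero.1 this).resolve_left n₂]
    · obtain ⟨r, hr, h⟩ := h.exists_eq_smul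
      obtain ⟨k₁, k₂⟩ := hind (y b₁ * u b₁ - 1 + r * (y a₁ * u a₁ - 1)) (y b₁ + r * y a₁) (by
        rw [v₁, v₂, ← sub_eq_zero] at h
        rw [← h]
        module)
      have h₃ : y b₁ * ((u a₁ - (y a₁)⁻¹) - (u b₁ - (y b₁)⁻¹)) = 0 := by
        have i₁ := mul_inv_cancel₀ n₁
        have i₂ := mul_inv_cancel₀ n₂
        linear_combination (u a₁ - (y a₁)⁻¹) * k₂ - k₁ + r * i₁ + i₂
      linarith [(mul_eq_zero.1 h₃).resolve_left n₂]
  have hinj : ∀ x ∈ A ∪ B, ∀ x' ∈ A ∪ B, u x = u x' →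
      u x - (y x)⁻¹ = u x' - (y x')⁻¹ → x = x' := by
    intro x hx x' hx' h1 h2
    have h3 : y x = y x' := inv_injective (by linarith)
    exact hφ (by rw [hval x hx, hval x' hx', h1, h3])
  rcases eq_const_of_axis_parallel (A := A) (B := B) (u := u) (w := fun x => u x - (y x)⁻¹)
    (fun x hx => sub_lt_self _ (inv_pos.2 (hyA x hx)))
    (fun x hx => by linarith [inv_lt_zero.2 (hyB x hx)])
    hpar hinj ha ha' haa hb hb' hbb with ⟨c, hc⟩ | ⟨c, hc⟩
  -- Constant `u` is a line through `s` with `t` exceptional; constant `w` is the reverse.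
  · refine exists_two_rays_of_line φ hφ t (φ s) (c • (φ t - φ s) + (φ a - φ s)) ?_
      (x := a) (y := a') (by rintro rfl; exact ht ha) (by rintro rfl; exact ht ha') haa
    intro x hx
    rcases hcov x with h | h | rfl | rfl
    · exact ⟨y x, by rw [hval x (Or.inl h), hc x (Or.inl h)]⟩
    · exact ⟨y x, by rw [hval x (Or.inr h), hc x (Or.inr h)]⟩
    · exact ⟨0, by simp⟩
    · exact absurd rfl hx
  · refine exists_two_rays_of_line φ hφ s (φ t) (c • (φ t - φ s) + (φ a - φ s)) ?_
      (x := a) (y := a') (by rintro rfl; exact hs ha) (by rintro rfl; exact hs ha') haa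
    have hline : ∀ x ∈ A ∪ B, ∃ r : ℝ, φ x = φ t + r • (c • (φ t - φ s) + (φ a - φ s)) := by
      intro x hx
      refine ⟨y x, ?_⟩
      have h0 := hyne x hx
      rw [hval x hx, ← hc x hx]
      match_scalars <;> field_simp <;> ring
    intro x hx
    rcases hcov x with h | h | rfl | rfl
    · exact hline x (Or.inl h)
    · exact hline x (Or.inr h)
    · exact absurd rfl hx
    · exact ⟨0, by simp⟩

/-! ### Connectivity of visibility graphs -/

/-- The visibility graph of points on a line is not `2`-connected. -/
theorem not_isVertexKConnected_two_of_line {X E : Type*} [Finite X] [AddCommGroup E]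
    [Module ℝ E] (G : SimpleGraph X) (φ : X → E) (hφ : Function.Injective φ)
    (hG : ∀ x y, G.Adj x y → ∀ z, ¬ Sbtw ℝ (φ x) (φ z) (φ y)) {o d : E}
    (h : ∀ x, ∃ r : ℝ, φ x = o + r • d) : ¬ G.IsVertexKConnected 2 := by
  rintro ⟨hcard, hconn⟩
  choose f hf using h
  have hinj : Function.Injective f := fun x y h => hφ (by rw [hf x, hf y, h])
  have hcard' : 2 < Nat.card X := by
    rw [ENat.card_eq_coe_natCard] at hcard
    exact_mod_cast hcard
  have : Nonempty X := (Nat.card_pos_iff.1 (by omega)).1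
  obtain ⟨u, hu, -⟩ := exists_strictMono_enumeration f hinj
  have h01 := hu 0 1 (by omega) (by omega)
  have h12 := hu 1 2 (by omega) (by omega)
  have hmem : ∀ x, f x ≠ f (u 1) → x ∈ (((({u 1} : Finset X)) : Set X)ᶜ) := by
    intro x hx
    simp only [Finset.coe_singleton, Set.mem_compl_iff, Set.mem_singleton_iff]
    rintro rfl
    exact hx rfl
  -- After deleting the second point of the line, some edge still has to jump over its place.
  obtain ⟨x, hx, y, hy, hxy⟩ :=
    (hconn {u 1} (by simp)).preconnected.exists_adj_of_mem_of_notMem {x | f x < f (u 1)}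
      (a := ⟨u 0, hmem _ h01.ne⟩) (b := ⟨u 2, hmem _ h12.ne'⟩) h01 (not_lt.2 h12.le)
  have hx' : f x < f (u 1) := hx
  have hy' : f (u 1) < f y := by
    refine lt_of_le_of_ne (not_lt.1 hy) fun h => y.2 ?_
    simp [hinj h]
  refine hG x y hxy (u 1) ?_
  have hd : 0 < f y - f x := by linarith
  rw [sbtw_iff_mem_image_Ioo_and_ne]
  refine ⟨⟨(f (u 1) - f x) / (f y - f x), ⟨div_pos (by linarith) hd,
    (div_lt_one hd).2 (by linarith)⟩, ?_⟩, hφ.ne ?_⟩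
  · rw [AffineMap.lineMap_apply_module', hf x, hf y, hf (u 1)]
    match_scalars <;> field_simp <;> ring
  · intro h
    rw [h] at hd
    linarith

/-- In a separated visibility graph every segment between the two sides contains a point of the
separating set. -/
theorem exists_sbtw_of_separation {X E : Type*} [Finite X] [NormedAddCommGroup E]
    [NormedSpace ℝ E] (φ : X → E)
    {A B S : Set X} (hcov : ∀ x, x ∈ A ∨ x ∈ B ∨ x ∈ S)
    (hAB : ∀ a ∈ A, ∀ b ∈ B, ∃ z, Sbtw ℝ (φ a) (φ z) (φ b)) :
    ∀ a ∈ A, ∀ b ∈ B, ∃ z ∈ S, Sbtw ℝ (φ a) (φ z) (φ b) := by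
  by_contra! hbad
  obtain ⟨a₀, ha₀, b₀, hb₀, h₀⟩ := hbad
  -- Take a shortest pair not blocked by `S`. A point of `A` or `B` between its ends would give a
  -- shorter such pair.
  obtain ⟨⟨a, b⟩, ⟨ha, hb, hab⟩, hmin⟩ := Set.exists_min_image
    {p : X × X | p.1 ∈ A ∧ p.2 ∈ B ∧ ∀ z ∈ S, ¬ Sbtw ℝ (φ p.1) (φ z) (φ p.2)}
    (fun p => dist (φ p.1) (φ p.2)) (Set.toFinite _) ⟨(a₀, b₀), ha₀, hb₀, h₀⟩
  obtain ⟨z, hz⟩ := hAB a ha b hb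
  have hd := hz.wbtw.dist_add_dist
  have hp₁ := dist_pos.2 hz.left_ne
  have hp₂ := dist_pos.2 hz.ne_right
  rcases hcov z with h | h | h
  · have := hmin (z, b) ⟨h, hb, fun w hw hs => hab w hw (hz.trans_right hs)⟩
    simp only at this
    linarith
  · have := hmin (a, z) ⟨ha, h, fun w hw hs => hab w hw (hz.trans_left hs)⟩
    simp only at this
    linarith
  · exact hab z h hz

theorem criticalGraph_adj_iff {X E : Type*} [MetricSpace X] [NormedAddCommGroup E]
    [NormedSpace ℝ E] [StrictConvexSpace ℝ E] (φ : X → E) (hφ : Isometry φ) (x y : X) :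
    (criticalGraph X).Adj x y ↔ x ≠ y ∧ ∀ z, ¬ Sbtw ℝ (φ x) (φ z) (φ y) := by
  change (x ≠ y ∧ ∀ z : X, z ≠ x → z ≠ y → dist x y < dist x z + dist z y) ↔ _
  refine and_congr_right fun _ => forall_congr' fun z => ?_
  rw [Sbtw, ← dist_add_dist_eq_iff, hφ.dist_eq, hφ.dist_eq, hφ.dist_eq, hφ.injective.ne_iff,
    hφ.injective.ne_iff]
  have := dist_triangle x z y
  constructor
  · rintro h ⟨h1, h2, h3⟩
    exact (h h2 h3).ne' h1
  · intro h h2 h3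
    exact lt_of_le_of_ne this fun h1 => h ⟨h1.symm, h2, h3⟩

/-- Points on two rays with common origin, not on one line, span two independent directions. -/
theorem independent_of_two_rays {X E : Type*} [AddCommGroup E] [Module ℝ E] (φ : X → E)
    (hnc : ¬ ∃ o d : E, ∀ x, ∃ r : ℝ, φ x = o + r • d) {v : X} {e₁ e₂ : E}
    (h : ∀ x, x ≠ v → ∃ r : ℝ, 0 < r ∧ (φ x - φ v = r • e₁ ∨ φ x - φ v = r • e₂)) (a b : ℝ)
    (hab : a • e₁ + b • e₂ = 0) : a = 0 ∧ b = 0 := by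
  have key : ∀ d : E, (∃ r : ℝ, e₁ = r • d) → (∃ r : ℝ, e₂ = r • d) → False := by
    rintro d ⟨r₁, rfl⟩ ⟨r₂, rfl⟩
    refine hnc ⟨φ v, d, fun x => ?_⟩
    by_cases hx : x = v
    · exact ⟨0, by simp [hx]⟩
    · obtain ⟨r, -, h | h⟩ := h x hx
      · exact ⟨r * r₁, by rw [mul_smul, ← h]; module⟩
      · exact ⟨r * r₂, by rw [mul_smul, ← h]; module⟩
  by_contra hne
  by_cases ha : a = 0
  · have hb : b ≠ 0 := fun hb => hne ⟨ha, hb⟩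
    have : e₂ = 0 := by simpa [ha, hb] using hab
    exact key e₁ ⟨1, by simp⟩ ⟨0, by simp [this]⟩
  · refine key e₂ ⟨-(b / a), ?_⟩ ⟨1, by simp⟩
    have h2 : a⁻¹ • (a • e₁ + b • e₂) = 0 := by rw [hab, smul_zero]
    rw [smul_add, smul_smul, smul_smul, inv_mul_cancel₀ ha, one_smul] at h2
    rw [eq_neg_of_add_eq_zero_left h2, div_eq_inv_mul, neg_smul]

/-- A `2`-connected visibility graph that is not `3`-connected is carried by two rays with common
origin. -/
theorem exists_two_rays_of_not_isVertexKConnected_three {X E : Type*} [Finite X]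
    [NormedAddCommGroup E] [NormedSpace ℝ E] (G : SimpleGraph X) (φ : X → E)
    (hφ : Function.Injective φ)
    (hG : ∀ x y, G.Adj x y ↔ x ≠ y ∧ ∀ z, ¬ Sbtw ℝ (φ x) (φ z) (φ y))
    (h2 : G.IsVertexKConnected 2) (h3 : ¬ G.IsVertexKConnected 3)
    (hnc : ¬ ∃ o d : E, ∀ x, ∃ r : ℝ, φ x = o + r • d) :
    ∃ v p q : X, ∀ x, x ≠ v → ∃ r : ℝ, 0 < r ∧
      (φ x - φ v = r • (φ p - φ v) ∨ φ x - φ v = r • (φ q - φ v)) := by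
  classical
  have := Fintype.ofFinite X
  have hcard : 2 < Fintype.card X := by
    have := h2.1
    rw [ENat.card_eq_coe_fintype_card] at this
    exact_mod_cast this
  -- Three points fail 3-connectedness by cardinality alone, so no separating pair need exist; any
  -- of them can be the apex.
  by_cases h4 : Fintype.card X = 3
  · obtain ⟨v, p, q, -, -, -, huniv⟩ := Finset.card_eq_three.1 (Finset.card_univ.trans h4)
    refine ⟨v, p, q, fun x hx => ⟨1, one_pos, ?_⟩⟩
    have hmem := Finset.mem_univ x
    rw [huniv] at hmem
    simp only [Finset.mem_insert, Finset.mem_singleton, hx, false_or] at hmem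
    exact hmem.imp (fun h => by rw [h, one_smul]) fun h => by rw [h, one_smul]
  obtain ⟨S, hS, hSc⟩ : ∃ S : Finset X, S.card < 3 ∧
      ¬ (G.induce ((S : Set X)ᶜ)).Connected := by
    by_contra! h
    refine h3 ⟨?_, h⟩
    rw [ENat.card_eq_coe_fintype_card]
    exact_mod_cast (by omega : 3 < Fintype.card X)
  have hS2 : S.card = 2 := by
    by_contra hne
    exact hSc (h2.2 S (by omega))
  obtain ⟨s, t, hst, rfl⟩ := Finset.card_eq_two.1 hS2
  have hnp : ¬ (G.induce ((({s, t} : Finset X) : Set X)ᶜ)).Preconnected := by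
    intro hp
    obtain ⟨x, -, hx⟩ := Finset.exists_mem_notMem_of_card_lt_card
      (s := {s, t}) (t := Finset.univ) (by rw [hS2, Finset.card_univ]; exact hcard)
    have : Nonempty ↥((({s, t} : Finset X) : Set X)ᶜ) := ⟨⟨x, hx⟩⟩
    exact hSc ⟨hp⟩
  obtain ⟨A, ⟨a, ha⟩, ⟨b, hb⟩, hAB⟩ := SimpleGraph.exists_separation_of_not_preconnected hnp
  have hcov : ∀ x, x ∈ Subtype.val '' A ∨ x ∈ Subtype.val '' Aᶜ ∨ x ∈ ({s, t} : Set X) := by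
    intro x
    by_cases hx : x ∈ ({s, t} : Set X)
    · exact Or.inr (Or.inr hx)
    · have hx' : x ∈ ((({s, t} : Finset X) : Set X)ᶜ) := by simpa using hx
      by_cases hxA : (⟨x, hx'⟩ : ↥((({s, t} : Finset X) : Set X)ᶜ)) ∈ A
      · exact Or.inl ⟨_, hxA, rfl⟩
      · exact Or.inr (Or.inl ⟨_, hxA, rfl⟩)
  have hsep := exists_sbtw_of_separation φ hcov (by
    rintro _ ⟨x, hx, rfl⟩ _ ⟨y, hy, rfl⟩
    by_contra! h
    refine hAB x hx y hy ((hG x y).2 ⟨fun hxy => hy ?_, h⟩)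
    rwa [← Subtype.ext hxy])
  refine exists_two_rays_of_separation φ hφ hnc hst hcov (fun x hx y hy => ?_)
    ⟨_, a, ha, rfl⟩ ⟨_, b, hb, rfl⟩ ?_ ?_
  · obtain ⟨z, rfl | rfl, hz⟩ := hsep x hx y hy
    · exact Or.inl hz
    · exact Or.inr hz
  · rintro ⟨x, -, h⟩
    exact x.2 (by simp [h])
  · rintro ⟨x, -, h⟩
    exact x.2 (by simp [h])

theorem mainTheorem2 {𝕜 X H : Type*} [RCLike 𝕜]
    [NormedAddCommGroup H] [InnerProductSpace 𝕜 H] [CompleteSpace H]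
    [MetricSpace X] [Finite X] [DecidableEq X]
    (φ : X → H) (hφ : Isometry φ)
    (h2 : (criticalGraph X).IsVertexKConnected 2)
    (h3 : ¬ (criticalGraph X).IsVertexKConnected 3) :
    ∃ (a b : X) (p : (criticalGraph X).Walk a b), p.IsHamiltonian ∧
      ∃ k : ℕ, 2 ≤ k ∧ k + 1 ≤ Nat.card X ∧
        ∀ i j : ℕ, 1 ≤ i → i < j → j ≤ Nat.card X →
          ((criticalGraph X).Adj (p.getVert (i - 1)) (p.getVert (j - 1)) ↔
            j = i + 1 ∨ (i < k ∧ k < j)) := by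
  -- Betweenness is a real notion, so complex scalars are restricted to real ones; the norm is
  -- unchanged.
  let _ : InnerProductSpace ℝ H := InnerProductSpace.rclikeToReal 𝕜 H
  have hG := criticalGraph_adj_iff φ hφ
  have hnc : ¬ ∃ o d : H, ∀ x, ∃ r : ℝ, φ x = o + r • d := fun ⟨_, _, h⟩ =>
    not_isVertexKConnected_two_of_line _ φ hφ.injective (fun x y h => ((hG x y).1 h).2) h h2
  obtain ⟨v, p, q, h⟩ :=
    exists_two_rays_of_not_isVertexKConnected_three _ φ hφ.injective hG h2 h3 hnc
  exact exists_hamiltonian_of_two_rays _ φ hφ.injective hG v p q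
    (independent_of_two_rays φ hnc h) h
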